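/- For a Boolean function $f:\{0,1\}^n\to\{0,1\}$ let $\hat f(a)=2^{-n}\sum_x(-1)^{f(x)\oplus x\cdot a}$ be its Walsh coefficients and $\hat f_{\max}=\max_a|\hat f(a)|$; $f$ is bent if $|\hat f(a)|=2^{-n/2}$ for all $a$. A quantum query algorithm accesses $f$ only through the unitary $|x,b,w\rangle\mapsto|x,b\oplus f(x),w\rangle$: it starts in a fixed basis state, interleaves queries with unitaries independent of $f$ on a finite-dimensional space, and finally measures in the computational basis and outputs a bit determined by the outcome. (1) $\hat f_{\max}=2^{-n/2}$ if and only if $f$ is bent, and for every even $n$ there is a bent function $f$ on $\{0,1\}^n$ with $\hat f(0^n)=2^{-n/2}$. (2) Let $f$ be bent with $\hat f(0^n)=2^{-n/2}$, and let $\lambda>0$ be such that $k=2\lambda\cdot 2^n$ is an integer not larger than the number of ones in the truth table of $f$. Let $Y_{f,\lambda}$ be the set of functions obtained from $f$ by flipping exactly $k$ ones of its truth table to zero. Then $Y_{f,\lambda}\ne\emptyset$, and $\hat g_{\max}=2^{-n/2}+4\lambda$ for every $g\in Y_{f,\lambda}$. (3) For every $\varepsilon\in[0,\tfrac12)$ there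 is a constant $c>0$, depending only on $\varepsilon$, such that the following hold. (a) Let $n\ge 0$ and $\lambda>0$ be such that there is an $n$-bit function $f$ with $\hat f_{\max}=2^{-n/2}$ and an $n$-bit function $g$ with $\hat g_{\max}=2^{-n/2}+4\lambda$. Then every quantum query algorithm that, given the oracle of an $n$-bit function $f$ with the promise that $\hat f_{\max}=2^{-n/2}$ or $\hat f_{\max}=2^{-n/2}+4\lambda$, decides which is the case with error probability at most $\varepsilon$, makes at least $c/\sqrt\lambda$ queries. (b) For $f$ and $\lambda$ as in (2), every quantum query algorithm that decides with error probability at most $\varepsilon$ whether its input is $f$ or belongs to $Y_{f,\lambda}$, given the promise that one of these is the case, makes at least $c/\sqrt\lambda$ queries. -/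

import Mathlib

open scoped Classical

noncomputable section

/-- The cube of `n`-bit strings, as the vector space of dimension `n` over the field `ZMod 2`. -/
abbrev Cube (n : ℕ) : Type := Fin n → ZMod 2

/-- Boolean functions with `n` input bits and one output bit (equivalently, truth tables). -/
abbrev BoolFun (n : ℕ) : Type := Cube n → ZMod 2

/-- The normalised Walsh coefficient `2⁻ⁿ ∑ₓ (-1) ^ (f(x) ⊕ x·a)`. -/
def walsh {n : ℕ} (f : BoolFun n) (a : Cube n) : ℝ :=
  (1 / (2 : ℝ) ^ n) * ∑ x : Cube n, (-1 : ℝ) ^ (f x + x ⬝ᵥ a).val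

/-- The largest absolute value of a Walsh coefficient. -/
def walshMax {n : ℕ} (f : BoolFun n) : ℝ :=
  Finset.univ.sup' Finset.univ_nonempty (fun a : Cube n => |walsh f a|)

/-- All Walsh coefficients have absolute value `1 / √(2ⁿ)`. -/
def IsBent {n : ℕ} (f : BoolFun n) : Prop :=
  ∀ a : Cube n, |walsh f a| = 1 / √((2 : ℝ) ^ n)

/-- Hamming weight of the truth table. -/
def weight {n : ℕ} (f : BoolFun n) : ℕ :=
  (Finset.univ.filter (fun x : Cube n => f x = 1)).card

/-- The functions obtained from `f` by flipping exactly `k` ones of its truth table to zero. -/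
def flips {n : ℕ} (f : BoolFun n) (k : ℕ) : Set (BoolFun n) :=
  {g | ∃ S : Finset (Cube n), S.card = k ∧ (∀ x ∈ S, f x = 1) ∧
    ∀ x, g x = if x ∈ S then 0 else f x}

/-- The permutation `(x, b, w) ↦ (x, b ⊕ f(x), w)` of the computational basis. -/
def oraclePerm {n : ℕ} (W : Type) (f : BoolFun n) :
    Equiv.Perm (Cube n × ZMod 2 × W) where
  toFun z := (z.1, z.2.1 + f z.1, z.2.2)
  invFun z := (z.1, z.2.1 - f z.1, z.2.2)
  left_inv z := by simp
  right_inv z := by simp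

/-- The query unitary, sending `|x, b, w⟩` to `|x, b ⊕ f(x), w⟩`. -/
def oracle {n : ℕ} (W : Type) [Fintype W] (f : BoolFun n) :
    EuclideanSpace ℂ (Cube n × ZMod 2 × W) ≃ₗᵢ[ℂ] EuclideanSpace ℂ (Cube n × ZMod 2 × W) :=
  LinearIsometryEquiv.piLpCongrLeft 2 ℂ ℂ (oraclePerm W f)

/-- The query unitary acts on computational basis states as stated. -/
theorem oracle_single {n : ℕ} (W : Type) [Fintype W] (f : BoolFun n)
    (x : Cube n) (b : ZMod 2) (w : W) :
    oracle W f (EuclideanSpace.single (x, b, w) 1) =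
      EuclideanSpace.single (x, b + f x, w) 1 := by
  have h := EuclideanSpace.piLpCongrLeft_single (𝕜 := ℂ) (oraclePerm W f) (x, b, w) (1 : ℂ)
  exact h

/-- A quantum query algorithm for `n`-bit Boolean functions with a binary answer. The registers
are an `n`-bit query register, an answer bit, and a work space of arbitrary finite dimension
with basis `W`. The algorithm starts in a basis state, applies unitaries that do not depend on
the input function, interleaved with `queries` calls to the oracle, finally measures in the
computational basis and outputs a bit computed from the outcome. Only the unitaries with index
`0, …, queries` are used. -/
structure QueryAlgorithm (n : ℕ) where
  W : Type
  [fintypeW : Fintype W]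
  queries : ℕ
  start : Cube n × ZMod 2 × W
  unitary : ℕ →
    (EuclideanSpace ℂ (Cube n × ZMod 2 × W) ≃ₗᵢ[ℂ] EuclideanSpace ℂ (Cube n × ZMod 2 × W))
  output : Cube n × ZMod 2 × W → Bool

attribute [instance] QueryAlgorithm.fintypeW

namespace QueryAlgorithm

variable {n : ℕ}

/-- The state `Uⱼ O_f Uⱼ₋₁ ⋯ U₁ O_f U₀ |start⟩`, after `j` queries to `f`. -/
def state (A : QueryAlgorithm n) (f : BoolFun n) :
    ℕ → EuclideanSpace ℂ (Cube n × ZMod 2 × A.W)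
  | 0 => A.unitary 0 (EuclideanSpace.single A.start 1)
  | j + 1 => A.unitary (j + 1) (oracle A.W f (A.state f j))

/-- The probability that the algorithm, run on the oracle of `f`, outputs the bit `b`. -/
def prob (A : QueryAlgorithm n) (f : BoolFun n) (b : Bool) : ℝ :=
  ∑ z ∈ Finset.univ.filter (fun z => A.output z = b), ‖A.state f A.queries z‖ ^ 2

/-- Under the promise that the input is in `X` or in `Y`, the algorithm decides which is the
case (answering `true` for `X` and `false` for `Y`) with probability of error at most `ε`. -/
def Decides (A : QueryAlgorithm n) (ε : ℝ) (X Y : Set (BoolFun n)) : Prop :=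
  (∀ f ∈ X, 1 - ε ≤ A.prob f true) ∧ (∀ f ∈ Y, 1 - ε ≤ A.prob f false)

end QueryAlgorithm

end

/-!
Adding an affine function to `f` only translates its Walsh coefficients and changes their signs,
so the largest one can be moved to `0`, where the coefficient counts the ones of the truth table.
Erasing `k` ones then raises this coefficient by `2k / 2ⁿ`, and no other coefficient by more.

The lower bound is a hybrid argument. In a run on `f`, the total squared amplitude with which
`T` queries address the ones of `f` is at most `T`, so some `k` of the ones receive at most the
share `k / weight f` of it, and by Cauchy–Schwarz erasing these moves the final state by at most
`2T √(k / weight f)`. An algorithm with bounded error must therefore make `Ω(√(weight f / k))`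
queries, and `weight f / k` is of order `1 / lam`.
-/

/-! ### Characters of the cube and Parseval's identity -/

/-- The sign `(-1) ^ a` of a bit `a`, as an additive character. -/
noncomputable def bitSign : AddChar (ZMod 2) ℝ :=
  AddChar.zmodChar 2 neg_one_sq

theorem bitSign_eq_ite (a : ZMod 2) : bitSign a = if a = 1 then -1 else 1 := by
  split_ifs with ha
  · simp [ha, bitSign, AddChar.zmodChar_apply, ZMod.val_one]
  · rw [show a = 0 from not_not.mp fun h => ha (Fin.eq_one_of_ne_zero a h),
      AddChar.map_zero_eq_one]

theorem bitSign_one : bitSign 1 = -1 := by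
  simp [bitSign_eq_ite]

theorem abs_bitSign (a : ZMod 2) : |bitSign a| = 1 := by
  rw [bitSign_eq_ite]
  split_ifs <;> simp

theorem bitSign_sq (a : ZMod 2) : bitSign a ^ 2 = 1 := by
  rw [← sq_abs, abs_bitSign, one_pow]

section Walsh

variable {n : ℕ}

theorem card_cube (n : ℕ) : Fintype.card (Cube n) = 2 ^ n := by
  simp [ZMod.card]

theorem cube_add_eq_zero_iff {x y : Cube n} : x + y = 0 ↔ x = y := by
  rw [← ZModModule.sub_eq_add, sub_eq_zero]

theorem sum_bitSign_dotProduct (u : Cube n) :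
    ∑ a : Cube n, bitSign (u ⬝ᵥ a) = if u = 0 then (2 : ℝ) ^ n else 0 := by
  split_ifs with hu
  · simp [hu, ZMod.card]
  · obtain ⟨i, hi⟩ := Function.ne_iff.mp hu
    let ψ : AddChar (Cube n) ℝ :=
      bitSign.compAddMonoidHom (AddMonoidHom.mk' (u ⬝ᵥ ·) (dotProduct_add u))
    have hψ : ψ ≠ 1 := by
      refine AddChar.ne_one_iff.mpr ⟨Pi.single i 1, ?_⟩
      have hui : u i = 1 := Fin.eq_one_of_ne_zero (u i) hi
      have hψi : ψ (Pi.single i 1) = -1 := by simp [ψ, hui, bitSign_one]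
      norm_num [hψi]
    exact AddChar.sum_eq_zero_of_ne_one hψ

theorem sum_sq_sum_mul_bitSign (F : Cube n → ℝ) :
    ∑ a : Cube n, (∑ x, F x * bitSign (x ⬝ᵥ a)) ^ 2 = 2 ^ n * ∑ x, F x ^ 2 := by
  calc ∑ a : Cube n, (∑ x, F x * bitSign (x ⬝ᵥ a)) ^ 2
      = ∑ a : Cube n, ∑ x, ∑ y, F x * F y * bitSign ((x + y) ⬝ᵥ a) := by
        simp only [sq, Finset.sum_mul_sum, add_dotProduct, AddChar.map_add_eq_mul, mul_mul_mul_comm]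
    _ = ∑ x, ∑ y, F x * F y * ∑ a : Cube n, bitSign ((x + y) ⬝ᵥ a) := by
        simp only [Finset.mul_sum]
        rw [Finset.sum_comm]
        exact Finset.sum_congr rfl fun x _ => Finset.sum_comm
    _ = 2 ^ n * ∑ x, F x ^ 2 := by
        simp only [sum_bitSign_dotProduct, cube_add_eq_zero_iff, mul_ite, mul_zero,
          Finset.sum_ite_eq, Finset.mem_univ, if_true, ← Finset.sum_mul, ← sq]
        exact mul_comm _ _

theorem walsh_eq_sum_bitSign (f : BoolFun n) (a : Cube n) :
    walsh f a = (∑ x, bitSign (f x) * bitSign (x ⬝ᵥ a)) / 2 ^ n := by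
  simp only [← AddChar.map_add_eq_mul]
  exact one_div_mul_eq_div _ _

theorem sum_sq_walsh (f : BoolFun n) : ∑ a, walsh f a ^ 2 = 1 := by
  simp only [walsh_eq_sum_bitSign, div_pow, ← Finset.sum_div, sum_sq_sum_mul_bitSign, bitSign_sq,
    Finset.sum_const, Finset.card_univ, card_cube, nsmul_eq_mul, Nat.cast_pow, Nat.cast_ofNat]
  field_simp

theorem abs_walsh_le_walshMax (f : BoolFun n) (a : Cube n) : |walsh f a| ≤ walshMax f :=
  Finset.le_sup' (fun a => |walsh f a|) (Finset.mem_univ a)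

theorem walshMax_le {f : BoolFun n} {c : ℝ} (h : ∀ a, |walsh f a| ≤ c) : walshMax f ≤ c :=
  Finset.sup'_le _ _ fun a _ => h a

theorem exists_abs_walsh_eq_walshMax (f : BoolFun n) : ∃ a, |walsh f a| = walshMax f := by
  obtain ⟨a, -, ha⟩ := Finset.exists_mem_eq_sup' Finset.univ_nonempty fun a => |walsh f a|
  exact ⟨a, ha.symm⟩

theorem walshMax_eq_iff_isBent (f : BoolFun n) :
    walshMax f = 1 / √((2 : ℝ) ^ n) ↔ IsBent f := by
  refine ⟨fun hf a => ?_, fun hf => ?_⟩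
  · have hsq_le (b : Cube n) (_ : b ∈ Finset.univ) :
        walsh f b ^ 2 ≤ (1 / √((2 : ℝ) ^ n)) ^ 2 := by
      rw [← sq_abs, ← hf]
      gcongr
      exact abs_walsh_le_walshMax f b
    have hsum : ∑ b, walsh f b ^ 2 = ∑ _b : Cube n, (1 / √((2 : ℝ) ^ n)) ^ 2 := by
      simp [sum_sq_walsh, ZMod.card]
    have hsq := (Finset.sum_eq_sum_iff_of_le hsq_le).mp hsum a (Finset.mem_univ a)
    rwa [sq_eq_sq_iff_abs_eq_abs, abs_of_nonneg (a := 1 / √_) (by positivity)] at hsq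
  · obtain ⟨a, ha⟩ := exists_abs_walsh_eq_walshMax f
    rw [← ha, hf a]

/-! ### The inner product function -/

theorem append_dotProduct {R : Type*} [NonUnitalNonAssocSemiring R] {k m : ℕ}
    (y : Fin k → R) (z : Fin m → R) (a : Fin (k + m) → R) :
    Fin.append y z ⬝ᵥ a = y ⬝ᵥ (a ∘ Fin.castAdd m) + z ⬝ᵥ (a ∘ Fin.natAdd k) := by
  simp [dotProduct, Fin.sum_univ_add]

/-- The inner product of the two halves of the input, the standard example of a bent function. -/
def halvesDot (m : ℕ) : BoolFun (m + m) :=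
  fun x => (x ∘ Fin.castAdd m) ⬝ᵥ (x ∘ Fin.natAdd m)

theorem halvesDot_append {m : ℕ} (y z : Cube m) : halvesDot m (Fin.append y z) = y ⬝ᵥ z := by
  simp only [halvesDot, dotProduct, Function.comp_apply, Fin.append_left, Fin.append_right]

theorem walsh_halvesDot {m : ℕ} (a : Cube (m + m)) :
    walsh (halvesDot m) a = bitSign (halvesDot m a) / √((2 : ℝ) ^ (m + m)) := by
  set p : Cube m := a ∘ Fin.castAdd m
  set q : Cube m := a ∘ Fin.natAdd m
  have hsum : ∑ x, bitSign (halvesDot m x) * bitSign (x ⬝ᵥ a) = bitSign (p ⬝ᵥ q) * 2 ^ m := by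
    calc ∑ x, bitSign (halvesDot m x) * bitSign (x ⬝ᵥ a)
        = ∑ y : Cube m, ∑ z : Cube m, bitSign (y ⬝ᵥ z) * bitSign (y ⬝ᵥ p + z ⬝ᵥ q) := by
          rw [← Equiv.sum_comp (Fin.appendEquiv m m), Fintype.sum_prod_type]
          simp only [Fin.appendEquiv, Equiv.coe_fn_mk, halvesDot_append, append_dotProduct, p, q]
      _ = ∑ y : Cube m, bitSign (y ⬝ᵥ p) * ∑ z, bitSign ((y + q) ⬝ᵥ z) := by
          simp only [Finset.mul_sum, ← AddChar.map_add_eq_mul, add_dotProduct, dotProduct_comm q]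
          simp only [add_left_comm]
      _ = bitSign (p ⬝ᵥ q) * 2 ^ m := by
          simp only [sum_bitSign_dotProduct, cube_add_eq_zero_iff, mul_ite, mul_zero,
            Finset.sum_ite_eq', Finset.mem_univ, if_true, dotProduct_comm q]
  rw [walsh_eq_sum_bitSign, hsum, pow_add, Real.sqrt_mul_self (by positivity)]
  simp only [halvesDot, p, q]
  field_simp

theorem isBent_halvesDot (m : ℕ) : IsBent (halvesDot m) := fun a => by
  rw [walsh_halvesDot, abs_div, abs_bitSign, abs_of_nonneg (Real.sqrt_nonneg _)]

theorem walsh_halvesDot_zero (m : ℕ) :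
    walsh (halvesDot m) 0 = 1 / √((2 : ℝ) ^ (m + m)) := by
  simp [walsh_halvesDot, halvesDot, dotProduct]

/-! ### Affine shifts, weights and flips -/

theorem walsh_add_affine (f : BoolFun n) (b : Cube n) (c : ZMod 2) (a : Cube n) :
    walsh (fun x => f x + (x ⬝ᵥ b + c)) a = bitSign c * walsh f (a + b) := by
  simp only [walsh_eq_sum_bitSign, AddChar.map_add_eq_mul, dotProduct_add, ← mul_div_assoc,
    Finset.mul_sum]
  congr! 2
  ring

theorem walshMax_add_affine (f : BoolFun n) (b : Cube n) (c : ZMod 2) :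
    walshMax (fun x => f x + (x ⬝ᵥ b + c)) = walshMax f := by
  have habs (a : Cube n) : |walsh (fun x => f x + (x ⬝ᵥ b + c)) a| = |walsh f (a + b)| := by
    rw [walsh_add_affine, abs_mul, abs_bitSign, one_mul]
  refine le_antisymm (walshMax_le fun a => ?_) (walshMax_le fun a => ?_)
  · rw [habs]
    exact abs_walsh_le_walshMax f _
  · rw [← sub_add_cancel a b, ← habs]
    exact abs_walsh_le_walshMax _ _

theorem exists_walsh_zero_eq_walshMax (f : BoolFun n) :
    ∃ h : BoolFun n, walshMax h = walshMax f ∧ walsh h 0 = walshMax f := by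
  obtain ⟨b, hb⟩ := exists_abs_walsh_eq_walshMax f
  rcases abs_choice (walsh f b) with hsign | hsign
  · refine ⟨_, walshMax_add_affine f b 0, ?_⟩
    rw [walsh_add_affine, AddChar.map_zero_eq_one, one_mul, zero_add, ← hb, hsign]
  · refine ⟨_, walshMax_add_affine f b 1, ?_⟩
    rw [walsh_add_affine, bitSign_one, neg_one_mul, zero_add, ← hb, hsign]

theorem walsh_zero_eq_one_sub_weight (f : BoolFun n) :
    walsh f 0 = 1 - 2 * weight f / 2 ^ n := by
  have hsign (x : Cube n) : bitSign (f x) = 1 - 2 * if f x = 1 then 1 else 0 := by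
    rw [bitSign_eq_ite]
    split_ifs <;> norm_num
  simp only [walsh_eq_sum_bitSign, dotProduct_zero, AddChar.map_zero_eq_one, mul_one, hsign,
    Finset.sum_sub_distrib, ← Finset.mul_sum, Finset.sum_boole, Finset.sum_const,
    Finset.card_univ, card_cube, nsmul_eq_mul, Nat.cast_pow, Nat.cast_ofNat, weight]
  field_simp

theorem walsh_zero_le_three_quarters {f : BoolFun n} (hf : walsh f 0 ≤ 1 / √((2 : ℝ) ^ n))
    (hpos : 0 < weight f) : walsh f 0 ≤ 3 / 4 := by
  rcases Nat.eq_zero_or_pos n with rfl | hn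
  · have : (1 : ℝ) ≤ weight f := mod_cast hpos
    rw [walsh_zero_eq_one_sub_weight, pow_zero, div_one]
    linarith
  · have hsqrt : (4 / 3 : ℝ) ≤ √((2 : ℝ) ^ n) := Real.le_sqrt_of_sq_le <|
      calc (4 / 3 : ℝ) ^ 2 ≤ 2 ^ 1 := by norm_num
        _ ≤ 2 ^ n := pow_le_pow_right₀ one_le_two hn
    calc walsh f 0 ≤ 1 / √((2 : ℝ) ^ n) := hf
      _ ≤ 1 / (4 / 3) := by gcongr
      _ = 3 / 4 := by norm_num

theorem two_mul_div_two_pow_eq {lam k : ℝ} (hk : k = 2 * lam * 2 ^ n) :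
    2 * k / 2 ^ n = 4 * lam := by
  rw [hk]
  field_simp
  ring

theorem exists_flip_count {lam : ℝ} (hlam : 0 < lam) {f g : BoolFun n}
    (hfg : walshMax g = walsh f 0 + 4 * lam) :
    ∃ k : ℕ, (k : ℝ) = 2 * lam * 2 ^ n ∧ k ≤ weight f := by
  obtain ⟨h, -, hh⟩ := exists_walsh_zero_eq_walshMax g
  rw [hfg, walsh_zero_eq_one_sub_weight, walsh_zero_eq_one_sub_weight] at hh
  have hdiff : (weight f : ℝ) - weight h = 2 * lam * 2 ^ n := by
    field_simp at hh
    linarith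
  have hle : weight h ≤ weight f := by
    have : (0 : ℝ) < 2 * lam * 2 ^ n := by positivity
    exact_mod_cast (by linarith : (weight h : ℝ) ≤ weight f)
  exact ⟨weight f - weight h, by rw [Nat.cast_sub hle, hdiff], Nat.sub_le _ _⟩

theorem ite_mem_flips {f : BoolFun n} {S : Finset (Cube n)}
    (hS : S ⊆ Finset.univ.filter fun x => f x = 1) :
    (fun x => if x ∈ S then 0 else f x) ∈ flips f S.card :=
  ⟨S, rfl, fun _ hx => (Finset.mem_filter.mp (hS hx)).2, fun _ => rfl⟩

theorem flips_nonempty (f : BoolFun n) {k : ℕ} (hk : k ≤ weight f) : (flips f k).Nonempty := by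
  obtain ⟨S, hS, rfl⟩ := Finset.exists_subset_card_eq hk
  exact ⟨_, ite_mem_flips hS⟩

theorem walsh_of_flip {f g : BoolFun n} {S : Finset (Cube n)} (hS : ∀ x ∈ S, f x = 1)
    (hg : ∀ x, g x = if x ∈ S then 0 else f x) (a : Cube n) :
    walsh g a = walsh f a + 2 * (∑ x ∈ S, bitSign (x ⬝ᵥ a)) / 2 ^ n := by
  have hsign (x : Cube n) : bitSign (g x) * bitSign (x ⬝ᵥ a) =
      bitSign (f x) * bitSign (x ⬝ᵥ a) + if x ∈ S then 2 * bitSign (x ⬝ᵥ a) else 0 := by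
    rw [hg x]
    split_ifs with hx
    · rw [hS x hx, bitSign_one, AddChar.map_zero_eq_one]
      ring
    · rw [add_zero]
  simp only [walsh_eq_sum_bitSign, hsign, Finset.sum_add_distrib, Finset.sum_ite_mem,
    Finset.univ_inter, ← Finset.mul_sum, add_div]

theorem walshMax_of_mem_flips {f g : BoolFun n} {k : ℕ} (hf : walsh f 0 = walshMax f)
    (hg : g ∈ flips f k) : walshMax g = walshMax f + 2 * k / 2 ^ n := by
  obtain ⟨S, rfl, hS, hgS⟩ := hg
  refine le_antisymm (walshMax_le fun a => ?_) ?_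
  · have hsum : |∑ x ∈ S, bitSign (x ⬝ᵥ a)| ≤ S.card :=
      (Finset.abs_sum_le_sum_abs _ _).trans_eq (by simp [abs_bitSign])
    calc |walsh g a| ≤ |walsh f a| + |2 * (∑ x ∈ S, bitSign (x ⬝ᵥ a)) / 2 ^ n| := by
          rw [walsh_of_flip hS hgS]
          exact abs_add_le _ _
      _ = |walsh f a| + 2 * |∑ x ∈ S, bitSign (x ⬝ᵥ a)| / 2 ^ n := by
          rw [abs_div, abs_mul, abs_two, abs_of_pos (a := (2 : ℝ) ^ n) (by positivity)]
      _ ≤ walshMax f + 2 * S.card / 2 ^ n := by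
          gcongr
          exact abs_walsh_le_walshMax f a
  · calc walshMax f + 2 * S.card / 2 ^ n = walsh g 0 := by
          simp [walsh_of_flip hS hgS, hf]
      _ ≤ walshMax g := (le_abs_self _).trans (abs_walsh_le_walshMax g 0)

end Walsh

/-! ### The hybrid argument -/

section Averaging

variable {α R : Type*} [CommRing R] [LinearOrder R] [IsStrictOrderedRing R]

theorem exists_mem_card_mul_sum_erase_le {t : Finset α} (ht : t.Nonempty) (w : α → R) :
    ∃ x ∈ t, (t.card : R) * ∑ y ∈ t.erase x, w y ≤ (t.card - 1) * ∑ y ∈ t, w y := by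
  obtain ⟨x, hx, hmax⟩ := t.exists_max_image w ht
  have hsum : ∑ y ∈ t, w y ≤ t.card * w x := by
    simpa using Finset.sum_le_card_nsmul t w (w x) hmax
  refine ⟨x, hx, ?_⟩
  rw [Finset.sum_erase_eq_sub hx]
  linarith

theorem exists_subset_card_eq_and_card_mul_sum_le (s : Finset α) (w : α → R) {k : ℕ}
    (hk : k ≤ s.card) :
    ∃ t ⊆ s, t.card = k ∧ (s.card : R) * ∑ x ∈ t, w x ≤ k * ∑ x ∈ s, w x := by
  induction hk using Nat.decreasingInduction with
  | self => exact ⟨s, subset_rfl, rfl, le_rfl⟩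
  | of_succ k _ ih =>
    obtain ⟨t, hts, htk, ht⟩ := ih
    have ht_nonempty : t.Nonempty := Finset.card_pos.mp (by lia)
    obtain ⟨x, hx, herase⟩ := exists_mem_card_mul_sum_erase_le ht_nonempty w
    refine ⟨t.erase x, (t.erase_subset x).trans hts, by simp [hx, htk], ?_⟩
    rw [htk, Nat.cast_succ, add_sub_cancel_right] at herase
    rw [Nat.cast_succ] at ht
    refine le_of_mul_le_mul_left ?_ (k.cast_add_one_pos (α := R))
    calc (k + 1 : R) * (s.card * ∑ y ∈ t.erase x, w y)
        = s.card * ((k + 1) * ∑ y ∈ t.erase x, w y) := by ring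
      _ ≤ s.card * (k * ∑ y ∈ t, w y) := by gcongr
      _ = k * (s.card * ∑ y ∈ t, w y) := by ring
      _ ≤ k * ((k + 1) * ∑ y ∈ s, w y) := by gcongr
      _ = (k + 1) * (k * ∑ y ∈ s, w y) := by ring

end Averaging

section Euclidean

variable {𝕜 ι : Type*} [RCLike 𝕜] [Fintype ι]

theorem sum_norm_mul_norm_le (s : Finset ι) (u v : EuclideanSpace 𝕜 ι) :
    ∑ i ∈ s, ‖u i‖ * ‖v i‖ ≤ ‖u‖ * ‖v‖ := by
  calc ∑ i ∈ s, ‖u i‖ * ‖v i‖ ≤ ∑ i, ‖u i‖ * ‖v i‖ :=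
        Finset.sum_le_univ_sum_of_nonneg fun _ => by positivity
    _ ≤ √(∑ i, ‖u i‖ ^ 2) * √(∑ i, ‖v i‖ ^ 2) := Real.sum_mul_le_sqrt_mul_sqrt _ _ _
    _ = ‖u‖ * ‖v‖ := by rw [EuclideanSpace.norm_eq, EuclideanSpace.norm_eq]

theorem sum_norm_sq_sub_sum_norm_sq_le (s : Finset ι) (u v : EuclideanSpace 𝕜 ι) :
    ∑ i ∈ s, ‖u i‖ ^ 2 - ∑ i ∈ s, ‖v i‖ ^ 2 ≤ ‖u - v‖ * (‖u‖ + ‖v‖) := by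
  calc ∑ i ∈ s, ‖u i‖ ^ 2 - ∑ i ∈ s, ‖v i‖ ^ 2
      = ∑ i ∈ s, (‖u i‖ - ‖v i‖) * (‖u i‖ + ‖v i‖) := by
        rw [← Finset.sum_sub_distrib]
        exact Finset.sum_congr rfl fun _ _ => by ring
    _ ≤ ∑ i ∈ s, ‖(u - v) i‖ * (‖u i‖ + ‖v i‖) := by
        gcongr with i
        exact norm_sub_norm_le _ _
    _ ≤ ‖u - v‖ * (‖u‖ + ‖v‖) := by
        simp only [mul_add, Finset.sum_add_distrib]
        exact add_le_add (sum_norm_mul_norm_le s _ u) (sum_norm_mul_norm_le s _ v)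

end Euclidean

section QueryMass

variable {n : ℕ} {W : Type} [Fintype W]

/-- The squared amplitude with which a query in the state `v` addresses the point `x`. -/
noncomputable def queryMass (v : EuclideanSpace ℂ (Cube n × ZMod 2 × W)) (x : Cube n) : ℝ :=
  ∑ p : ZMod 2 × W, ‖v (x, p)‖ ^ 2

theorem queryMass_nonneg (v : EuclideanSpace ℂ (Cube n × ZMod 2 × W)) (x : Cube n) :
    0 ≤ queryMass v x :=
  Finset.sum_nonneg fun _ _ => by positivity

theorem sum_queryMass (v : EuclideanSpace ℂ (Cube n × ZMod 2 × W)) :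
    ∑ x, queryMass v x = ‖v‖ ^ 2 := by
  rw [EuclideanSpace.norm_sq_eq, Fintype.sum_prod_type]
  rfl

theorem queryMass_sub_le (u v : EuclideanSpace ℂ (Cube n × ZMod 2 × W)) (x : Cube n) :
    queryMass (u - v) x ≤ 2 * (queryMass u x + queryMass v x) := by
  simp only [queryMass, ← Finset.sum_add_distrib, Finset.mul_sum]
  gcongr with p
  calc ‖(u - v) (x, p)‖ ^ 2 ≤ (‖u (x, p)‖ + ‖v (x, p)‖) ^ 2 := by
        gcongr
        exact norm_sub_le _ _
    _ ≤ 2 * (‖u (x, p)‖ ^ 2 + ‖v (x, p)‖ ^ 2) := add_sq_le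

theorem oracle_apply (f : BoolFun n) (v : EuclideanSpace ℂ (Cube n × ZMod 2 × W))
    (z : Cube n × ZMod 2 × W) : oracle W f v z = v (z.1, z.2.1 - f z.1, z.2.2) :=
  rfl

theorem queryMass_oracle (f : BoolFun n) (v : EuclideanSpace ℂ (Cube n × ZMod 2 × W))
    (x : Cube n) : queryMass (oracle W f v) x = queryMass v x := by
  simp only [queryMass, oracle_apply, Fintype.sum_prod_type]
  exact Equiv.sum_comp (Equiv.subRight (f x)) fun b => ∑ w, ‖v (x, b, w)‖ ^ 2

theorem norm_oracle_sub_oracle_sq_le {f g : BoolFun n} {S : Finset (Cube n)}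
    (h : ∀ x ∉ S, g x = f x) (v : EuclideanSpace ℂ (Cube n × ZMod 2 × W)) :
    ‖oracle W g v - oracle W f v‖ ^ 2 ≤ 4 * ∑ x ∈ S, queryMass v x := by
  have hout (x : Cube n) (hx : x ∉ S) : queryMass (oracle W g v - oracle W f v) x = 0 := by
    simp [queryMass, oracle_apply, h x hx]
  calc ‖oracle W g v - oracle W f v‖ ^ 2
      = ∑ x ∈ S, queryMass (oracle W g v - oracle W f v) x := by
        rw [← sum_queryMass]
        exact (Finset.sum_subset S.subset_univ fun x _ => hout x).symm
    _ ≤ ∑ x ∈ S, 4 * queryMass v x := by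
        refine Finset.sum_le_sum fun x _ => (queryMass_sub_le _ _ x).trans_eq ?_
        rw [queryMass_oracle, queryMass_oracle]
        ring
    _ = 4 * ∑ x ∈ S, queryMass v x := (Finset.mul_sum _ _ _).symm

end QueryMass

namespace QueryAlgorithm

variable {n : ℕ} (A : QueryAlgorithm n)

theorem norm_state (f : BoolFun n) (j : ℕ) : ‖A.state f j‖ = 1 := by
  induction j with
  | zero => simp [state]
  | succ j ih => simp [state, ih]

theorem prob_false_add_prob_true (f : BoolFun n) : A.prob f false + A.prob f true = 1 := by
  have h := Finset.sum_filter_add_sum_filter_not Finset.univ (fun z => A.output z = false)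
    fun z => ‖A.state f A.queries z‖ ^ 2
  rw [← EuclideanSpace.norm_sq_eq, norm_state, one_pow] at h
  simpa [prob] using h

theorem prob_sub_prob_le (f g : BoolFun n) (b : Bool) :
    A.prob g b - A.prob f b ≤ 2 * ‖A.state g A.queries - A.state f A.queries‖ := by
  refine (sum_norm_sq_sub_sum_norm_sq_le _ _ _).trans_eq ?_
  rw [norm_state, norm_state]
  ring

theorem sum_sum_queryMass_state (f : BoolFun n) (j : ℕ) :
    ∑ x, ∑ i ∈ Finset.range j, queryMass (A.state f i) x = j := by
  rw [Finset.sum_comm]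
  simp [sum_queryMass, norm_state]

theorem norm_state_sub_le (f g : BoolFun n) (j : ℕ) :
    ‖A.state g j - A.state f j‖ ≤
      ∑ i ∈ Finset.range j, ‖oracle A.W g (A.state f i) - oracle A.W f (A.state f i)‖ := by
  induction j with
  | zero => simp [state]
  | succ j ih =>
    rw [Finset.sum_range_succ, state, state, ← map_sub, LinearIsometryEquiv.norm_map]
    calc ‖oracle A.W g (A.state g j) - oracle A.W f (A.state f j)‖
        ≤ ‖oracle A.W g (A.state g j) - oracle A.W g (A.state f j)‖ +
            ‖oracle A.W g (A.state f j) - oracle A.W f (A.state f j)‖ :=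
          norm_sub_le_norm_sub_add_norm_sub _ _ _
      _ ≤ _ := by
          rw [← map_sub, LinearIsometryEquiv.norm_map]
          gcongr

theorem norm_state_sub_sq_le {f g : BoolFun n} {S : Finset (Cube n)}
    (h : ∀ x ∉ S, g x = f x) (j : ℕ) :
    ‖A.state g j - A.state f j‖ ^ 2 ≤
      4 * j * ∑ x ∈ S, ∑ i ∈ Finset.range j, queryMass (A.state f i) x := by
  calc ‖A.state g j - A.state f j‖ ^ 2
      ≤ (∑ i ∈ Finset.range j,
          ‖oracle A.W g (A.state f i) - oracle A.W f (A.state f i)‖) ^ 2 := by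
        gcongr
        exact A.norm_state_sub_le f g j
    _ ≤ j * ∑ i ∈ Finset.range j,
          ‖oracle A.W g (A.state f i) - oracle A.W f (A.state f i)‖ ^ 2 := by
        simpa only [Finset.card_range] using sq_sum_le_card_mul_sum_sq (s := Finset.range j)
          (f := fun i => ‖oracle A.W g (A.state f i) - oracle A.W f (A.state f i)‖)
    _ ≤ j * ∑ i ∈ Finset.range j, 4 * ∑ x ∈ S, queryMass (A.state f i) x := by
        gcongr
        exact norm_oracle_sub_oracle_sq_le h _
    _ = 4 * j * ∑ x ∈ S, ∑ i ∈ Finset.range j, queryMass (A.state f i) x := by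
        rw [← Finset.mul_sum, Finset.sum_comm]
        ring

theorem exists_mem_flips_norm_state_sub_sq_le (f : BoolFun n) {k : ℕ} (hk : k ≤ weight f)
    (j : ℕ) :
    ∃ g ∈ flips f k, weight f * ‖A.state g j - A.state f j‖ ^ 2 ≤ 4 * k * (j : ℝ) ^ 2 := by
  set mass : Cube n → ℝ := fun x => ∑ i ∈ Finset.range j, queryMass (A.state f i) x
  obtain ⟨S, hS, rfl, hmass⟩ := exists_subset_card_eq_and_card_mul_sum_le
    (Finset.univ.filter fun x => f x = 1) mass hk
  have htotal : ∑ x with f x = 1, mass x ≤ j :=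
    (Finset.sum_le_univ_sum_of_nonneg fun x =>
      Finset.sum_nonneg fun i _ => queryMass_nonneg _ _).trans_eq (A.sum_sum_queryMass_state f j)
  refine ⟨_, ite_mem_flips hS, ?_⟩
  calc (weight f : ℝ) * ‖A.state (fun x => if x ∈ S then 0 else f x) j - A.state f j‖ ^ 2
      ≤ weight f * (4 * j * ∑ x ∈ S, mass x) := by
        gcongr
        exact A.norm_state_sub_sq_le (fun x hx => if_neg hx) j
    _ = 4 * j * (weight f * ∑ x ∈ S, mass x) := by ring
    _ ≤ 4 * j * (S.card * j) := by
        refine mul_le_mul_of_nonneg_left (hmass.trans ?_) (by positivity)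
        gcongr
    _ = 4 * S.card * (j : ℝ) ^ 2 := by ring

namespace Decides

variable {A} {ε lam : ℝ} {X Y : Set (BoolFun n)} {f g : BoolFun n} {k : ℕ}

theorem le_norm_state_sub (hA : A.Decides ε X Y) (hf : f ∈ X) (hg : g ∈ Y) :
    1 - 2 * ε ≤ 2 * ‖A.state g A.queries - A.state f A.queries‖ := by
  linarith [hA.1 f hf, hA.2 g hg, A.prob_false_add_prob_true f, A.prob_sub_prob_le f g false]

theorem sq_mul_weight_le (hA : A.Decides ε {f} (flips f k)) (hε : ε ≤ 1 / 2)
    (hk : k ≤ weight f) :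
    (1 - 2 * ε) ^ 2 * weight f ≤ 16 * k * (A.queries : ℝ) ^ 2 := by
  obtain ⟨g, hg, hdist⟩ := A.exists_mem_flips_norm_state_sub_sq_le f hk A.queries
  calc (1 - 2 * ε) ^ 2 * weight f
      ≤ (2 * ‖A.state g A.queries - A.state f A.queries‖) ^ 2 * weight f := by
        gcongr
        · linarith
        · exact hA.le_norm_state_sub rfl hg
    _ = 4 * (weight f * ‖A.state g A.queries - A.state f A.queries‖ ^ 2) := by ring
    _ ≤ 4 * (4 * k * (A.queries : ℝ) ^ 2) := by gcongr
    _ = 16 * k * (A.queries : ℝ) ^ 2 := by ring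

theorem sq_mul_one_sub_walsh_le (hA : A.Decides ε {f} (flips f k)) (hε : ε ≤ 1 / 2)
    (hk : (k : ℝ) = 2 * lam * 2 ^ n) (hkf : k ≤ weight f) :
    (1 - 2 * ε) ^ 2 * (1 - walsh f 0) ≤ 64 * (lam * (A.queries : ℝ) ^ 2) := by
  have h := hA.sq_mul_weight_le hε hkf
  rw [hk] at h
  rw [walsh_zero_eq_one_sub_weight, sub_sub_cancel, mul_div_assoc', div_le_iff₀ (by positivity)]
  linarith

theorem div_sqrt_le_queries (hA : A.Decides ε {f} (flips f k)) (hε : ε ≤ 1 / 2)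
    (hlam : 0 < lam) (hf : walsh f 0 ≤ 1 / √((2 : ℝ) ^ n)) (hk : (k : ℝ) = 2 * lam * 2 ^ n)
    (hkf : k ≤ weight f) :
    (1 - 2 * ε) / 16 / √lam ≤ A.queries := by
  have hk_pos : 0 < k := Nat.cast_pos.mp (hk ▸ by positivity : (0 : ℝ) < k)
  have hwalsh := walsh_zero_le_three_quarters hf (hk_pos.trans_le hkf)
  rw [div_le_iff₀ (Real.sqrt_pos.mpr hlam)]
  refine le_of_sq_le_sq ?_ (by positivity)
  rw [mul_pow, Real.sq_sqrt hlam.le]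
  calc ((1 - 2 * ε) / 16) ^ 2 = (1 - 2 * ε) ^ 2 * (1 - 3 / 4) / 64 := by ring
    _ ≤ (1 - 2 * ε) ^ 2 * (1 - walsh f 0) / 64 := by gcongr
    _ ≤ 64 * (lam * (A.queries : ℝ) ^ 2) / 64 :=
        div_le_div_of_nonneg_right (hA.sq_mul_one_sub_walsh_le hε hk hkf) (by norm_num)
    _ = (A.queries : ℝ) ^ 2 * lam := by ring

theorem exists_decides_flips {w : ℝ} (hlam : 0 < lam) (hf : walshMax f = w)
    (hg : walshMax g = w + 4 * lam)
    (hA : A.Decides ε {f | walshMax f = w} {g | walshMax g = w + 4 * lam}) :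
    ∃ (h : BoolFun n) (k : ℕ), walsh h 0 = w ∧ (k : ℝ) = 2 * lam * 2 ^ n ∧ k ≤ weight h ∧
      A.Decides ε {h} (flips h k) := by
  obtain ⟨h, hmax, hzero⟩ := exists_walsh_zero_eq_walshMax f
  rw [hf] at hmax hzero
  obtain ⟨k, hk, hkh⟩ := exists_flip_count hlam (hg.trans (by rw [hzero]))
  refine ⟨h, k, hzero, hk, hkh, fun _ h_eq => hA.1 _ (h_eq ▸ hmax), fun g' hg' => hA.2 g' <|
    (walshMax_of_mem_flips (hzero.trans hmax.symm) hg').trans ?_⟩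
  rw [hmax, two_mul_div_two_pow_eq hk]

end Decides

end QueryAlgorithm

theorem theorem6p4_general :
    (∀ (n : ℕ) (f : BoolFun n), walshMax f = 1 / √((2 : ℝ) ^ n) ↔ IsBent f) ∧
    (∀ n : ℕ, Even n → ∃ f : BoolFun n, IsBent f ∧ walsh f 0 = 1 / √((2 : ℝ) ^ n)) ∧
    (∀ (n : ℕ) (lam w : ℝ) (f : BoolFun n) (k : ℕ), walshMax f = w → walsh f 0 = w →
      (k : ℝ) = 2 * lam * 2 ^ n → k ≤ weight f →
        (flips f k).Nonempty ∧ ∀ g ∈ flips f k, walshMax g = w + 4 * lam) ∧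
    (∀ ε : ℝ, ε < 1 / 2 → ∃ c : ℝ, 0 < c ∧
      (∀ (n : ℕ) (lam : ℝ), 0 < lam →
        (∃ f : BoolFun n, walshMax f = 1 / √((2 : ℝ) ^ n)) →
        (∃ g : BoolFun n, walshMax g = 1 / √((2 : ℝ) ^ n) + 4 * lam) →
        ∀ A : QueryAlgorithm n,
          A.Decides ε {f | walshMax f = 1 / √((2 : ℝ) ^ n)}
            {g | walshMax g = 1 / √((2 : ℝ) ^ n) + 4 * lam} →
          c / √lam ≤ (A.queries : ℝ)) ∧
      (∀ (n : ℕ) (lam : ℝ) (f : BoolFun n) (k : ℕ), 0 < lam →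
        walsh f 0 ≤ 1 / √((2 : ℝ) ^ n) → (k : ℝ) = 2 * lam * 2 ^ n → k ≤ weight f →
        ∀ A : QueryAlgorithm n, A.Decides ε {f} (flips f k) →
          c / √lam ≤ (A.queries : ℝ))) := by
  refine ⟨fun _ => walshMax_eq_iff_isBent, ?_, ?_, fun ε hε => ?_⟩
  · rintro _ ⟨m, rfl⟩
    exact ⟨halvesDot m, isBent_halvesDot m, walsh_halvesDot_zero m⟩
  · rintro n lam w f k rfl hzero hk hkf
    exact ⟨flips_nonempty f hkf, fun g hg =>
      (walshMax_of_mem_flips hzero hg).trans (by rw [two_mul_div_two_pow_eq hk])⟩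
  · refine ⟨(1 - 2 * ε) / 16, by linarith, ?_, fun n lam f k hlam hf hk hkf A hA =>
      hA.div_sqrt_le_queries hε.le hlam hf hk hkf⟩
    rintro n lam hlam ⟨f, hf⟩ ⟨g, hg⟩ A hA
    obtain ⟨h, k, hzero, hk, hkh, hA'⟩ := hA.exists_decides_flips hlam hf hg
    exact hA'.div_sqrt_le_queries hε.le hlam hzero.le hk hkh

theorem theorem6p4 :
    -- the first case of the promise describes the bent functions
    (∀ (n : ℕ) (f : BoolFun n), walshMax f = 1 / √((2 : ℝ) ^ n) ↔ IsBent f) ∧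
    -- the bent functions used for the hard instances exist for every even `n`
    (∀ n : ℕ, Even n → ∃ f : BoolFun n, IsBent f ∧ walsh f 0 = 1 / √((2 : ℝ) ^ n)) ∧
    -- flipping `2 lam 2ⁿ` ones of such a function to zero gives the second case of the promise
    (∀ (n : ℕ) (lam : ℝ) (f : BoolFun n) (k : ℕ), 0 < lam → IsBent f →
      walsh f 0 = 1 / √((2 : ℝ) ^ n) → (k : ℝ) = 2 * lam * 2 ^ n → k ≤ weight f →
        (flips f k).Nonempty ∧
        ∀ g ∈ flips f k, walshMax g = 1 / √((2 : ℝ) ^ n) + 4 * lam) ∧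
    -- the lower bound, with a constant that depends on the allowed error probability only
    (∀ ε : ℝ, 0 ≤ ε → ε < 1 / 2 → ∃ c : ℝ, 0 < c ∧
      -- for the decision problem, whenever both cases can occur
      (∀ (n : ℕ) (lam : ℝ), 0 < lam →
        (∃ f : BoolFun n, walshMax f = 1 / √((2 : ℝ) ^ n)) →
        (∃ g : BoolFun n, walshMax g = 1 / √((2 : ℝ) ^ n) + 4 * lam) →
        ∀ A : QueryAlgorithm n,
          A.Decides ε {f | walshMax f = 1 / √((2 : ℝ) ^ n)}
            {g | walshMax g = 1 / √((2 : ℝ) ^ n) + 4 * lam} →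
          c / √lam ≤ (A.queries : ℝ)) ∧
      -- already for the hard instances
      (∀ (n : ℕ) (lam : ℝ) (f : BoolFun n) (k : ℕ), 0 < lam → IsBent f →
        walsh f 0 = 1 / √((2 : ℝ) ^ n) → (k : ℝ) = 2 * lam * 2 ^ n → k ≤ weight f →
        ∀ A : QueryAlgorithm n, A.Decides ε {f} (flips f k) →
          c / √lam ≤ (A.queries : ℝ))) := by
  obtain ⟨hbent, hexists, hflips, hqueries⟩ := theorem6p4_general
  exact ⟨hbent, hexists, fun n lam f k _ hf => hflips n lam _ f k ((hbent n f).mpr hf),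
    fun ε _ hε => (hqueries ε hε).imp fun _ ⟨hc, hpromise, hhard⟩ => ⟨hc, hpromise,
      fun n lam f k hlam _ hf => hhard n lam f k hlam hf.le⟩⟩
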